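/- Let $\mathfrak b$ be the smallest cardinality of a set $B\subset\omega^\omega$ such that for every $y\in\omega^\omega$ there is $x\in B$ with $x\not\le^* y$, where $x\le^* y$ means that $\{n\in\omega : x(n)\not\le y(n)\}$ is finite. A topological space is called Čech-complete if it is Tychonoff and is a $G_\delta$-subset of some Hausdorff compactification of it. A topological space is called analytic if it is a continuous image of a Polish space, and K-analytic if it is a continuous image of a Lindelöf Čech-complete space. (No separation axiom is included in the notions "compact", "analytic" and "K-analytic"; "countable" means at most countable.) Theorem. The following conditions are equivalent: 1. $\omega_1<\mathfrak b$; 2. for every K-analytic Hausdorff space $X$: $X$ is analytic if and only if every compact subset of $X$ is metrizable; 3. for every K-analytic space $X$: $X$ is countable if and only if every compact subset of $X$ is countable; 4. for every K-analytic Hausdorff space $X$ with a unique non-isolated point: $X$ is countable if and only if every compact subset of $X$ is countable. -/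

import Mathlib

universe u

/-- Eventual domination `x ≤* y` on `ℕ → ℕ`: the set `{n | x n ≰ y n}` is finite. -/
def EventuallyDominated (x y : ℕ → ℕ) : Prop :=
  {n : ℕ | ¬ x n ≤ y n}.Finite

/-- The bounding number `𝔟`: the smallest cardinality of a set `B` of functions `ℕ → ℕ` such that
for every `y` there is `x ∈ B` with `x ≰* y`. The set of candidates is non-empty (take all
functions for `B`), so the infimum is attained. -/
noncomputable def boundingNumber : Cardinal.{0} :=
  sInf {κ : Cardinal.{0} | ∃ B : Set (ℕ → ℕ),
    Cardinal.mk B = κ ∧ ∀ y : ℕ → ℕ, ∃ x ∈ B, ¬ EventuallyDominated x y}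

/-- A space is Čech-complete if it is Tychonoff and is a `G_δ`-set in some (Hausdorff)
compactification. -/
def IsCechComplete (P : Type u) [TopologicalSpace P] : Prop :=
  T35Space P ∧ ∃ (C : Type u) (_ : TopologicalSpace C) (_ : CompactSpace C) (_ : T2Space C)
    (e : P → C), IsDenseEmbedding e ∧ IsGδ (Set.range e)

/-- A space is K-analytic if it is a continuous image of a Lindelöf Čech-complete space.
No separation axiom is imposed on `X`. -/
def IsKAnalyticSpace (X : Type u) [TopologicalSpace X] : Prop :=
  ∃ (P : Type u) (_ : TopologicalSpace P), IsCechComplete P ∧ LindelofSpace P ∧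
    ∃ f : P → X, Continuous f ∧ Function.Surjective f

/-- A space is analytic if it is a continuous image of a Polish space. -/
def IsAnalyticSpace (X : Type u) [TopologicalSpace X] : Prop :=
  ∃ (P : Type u) (_ : TopologicalSpace P), PolishSpace P ∧
    ∃ f : P → X, Continuous f ∧ Function.Surjective f

/-- The space has exactly one non-isolated point. -/
def HasUniqueNonisolatedPoint (X : Type u) [TopologicalSpace X] : Prop :=
  ∃! x : X, ¬ IsOpen ({x} : Set X)

/-!
The theorem rests on two facts.

**If `ω₁ < 𝔟`, then K-analytic spaces are controlled by their compact subsets.** A Lindelöf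
Čech-complete space `P` sits in a compact Hausdorff space as a set `⋂ n, ⋃ k, F n k` with `F n k`
closed. Replacing `⋃ k` by `⋃ k ≤ α n` shows that every continuous image `X` of `P` is the union
of compact sets `K α`, `α : ℕ → ℕ`, with `K` monotone (`IsKAnalyticSpace.exists_compact_resolution`).
If `ω₁ < 𝔟`, then among `ℵ₁` functions uncountably many lie pointwise below a single one
(`exists_not_countable_setOf_le`), hence among `ℵ₁` points of `X` uncountably many lie in a single
`K α`. If compact sets are countable, `X` must therefore be countable. If compact sets are
metrizable, the same argument in `X × X`, applied to a right-separated `ω₁`-sequence, shows that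
`X × X` is hereditarily Lindelöf (`hereditarilyLindelofSpace_of_resolution`). For a Hausdorff `X`
the complement of the diagonal is then covered by countably many open boxes `A n ×ˢ B n` with
`A n` and `B n` disjoint. Every point avoids `A n` or `B n`, so recording which set is avoided,
together with the indices `k` of the sets `F n k` containing a preimage, gives closed sets on whose
intersections the map `P → X` is constant; this makes `X` a continuous image of a closed subset of
a countable power of `ℕ` (`isAnalyticSpace_of_closed_scheme`). Conversely the square of a compact
subset of an analytic Hausdorff space is hereditarily Lindelöf, and countably many separating pairs
generate a coarser, hence equal, second countable Hausdorff topology on it.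

**If `𝔟 ≤ ω₁`, there is an uncountable K-analytic Hausdorff space with a unique non-isolated point
whose compact subsets are countable.** Dominating the initial segments of an unbounded family of
size `≤ ℵ₁` yields an uncountable family `b : I → ℕ → ℕ` with only countably many members below any
given function. In the space `BoundedFan b` a point is added to the discrete set `I`, with the
finest topology in which each `{i | b i ≤ α}` converges to it. Compact subsets are bounded and
hence countable, and the space is a continuous image of a closed subset of `(ℕ → ℕ) × OnePoint I`,
where `I` is discrete.

The second statement implies the fourth because countable compact Hausdorff spaces are metrizable,
and an analytic space is separable, so that it has only countably many isolated points.
-/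

section
open Set Filter Topology
open Cardinal hiding univ

/-! ### Compact resolutions of K-analytic spaces -/

/-- A Lindelöf Čech-complete space is a countable intersection of `F_σ`-sets in a compact
Hausdorff space: each open set of a `G_δ` representation is replaced by countably many closed
subsets of it that still cover the space. -/
theorem IsCechComplete.exists_range_eq_iInter_iUnion_isClosed {P : Type u} [TopologicalSpace P]
    (hP : IsCechComplete P) [LindelofSpace P] :
    ∃ (C : Type u) (_ : TopologicalSpace C) (_ : CompactSpace C) (_ : T2Space C)
      (e : P → C) (F : ℕ → ℕ → Set C), IsEmbedding e ∧ (∀ n k, IsClosed (F n k)) ∧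
        range e = ⋂ n, ⋃ k, F n k := by
  obtain ⟨-, C, _, _, _, e, he, hG⟩ := hP
  obtain ⟨U, hU, hr⟩ := hG.eq_iInter_nat
  have key (n : ℕ) : ∃ F : ℕ → Set C, (∀ k, IsClosed (F k)) ∧ (∀ k, F k ⊆ U n) ∧
      range e ⊆ ⋃ k, F k := by
    -- Countable families of closed sets contained in `U n` are indexed by `ℕ` even if `P` is empty.
    have : Nonempty {t : Set C // IsClosed t ∧ t ⊆ U n} := ⟨⟨∅, isClosed_empty, empty_subset _⟩⟩
    obtain ⟨r, hcov⟩ := (isLindelof_univ (X := P)).indexed_countable_subcover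
      (fun t : {t : Set C // IsClosed t ∧ t ⊆ U n} ↦ e ⁻¹' interior t.1)
      (fun t ↦ isOpen_interior.preimage he.continuous) (fun p _ ↦ by
        have hp : e p ∈ U n := by
          have : e p ∈ ⋂ n, U n := hr ▸ mem_range_self p
          exact mem_iInter.1 this n
        obtain ⟨t, ht, htc, htU⟩ := exists_mem_nhds_isClosed_subset ((hU n).mem_nhds hp)
        exact mem_iUnion.2 ⟨⟨t, htc, htU⟩, mem_interior_iff_mem_nhds.2 ht⟩)
    refine ⟨fun k ↦ (r k).1, fun k ↦ (r k).2.1, fun k ↦ (r k).2.2, ?_⟩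
    rintro _ ⟨p, rfl⟩
    obtain ⟨k, hk⟩ := mem_iUnion.1 (hcov (mem_univ p))
    exact mem_iUnion.2 ⟨k, interior_subset hk⟩
  choose F hFc hFU hF using key
  refine ⟨C, inferInstance, inferInstance, inferInstance, e, F, he.isEmbedding, hFc, ?_⟩
  refine subset_antisymm (subset_iInter fun n ↦ hF n) ?_
  rw [hr]
  exact iInter_mono fun n ↦ iUnion_subset (hFU n)

/-- A K-analytic space is covered by compact sets indexed monotonically by `ℕ → ℕ`. -/
theorem IsKAnalyticSpace.exists_compact_resolution {X : Type u} [TopologicalSpace X]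
    (hX : IsKAnalyticSpace X) :
    ∃ K : (ℕ → ℕ) → Set X, Monotone K ∧ (∀ α, IsCompact (K α)) ∧ ∀ x, ∃ α, x ∈ K α := by
  obtain ⟨P, _, hP, _, f, hf, hfs⟩ := hX
  obtain ⟨C, _, _, _, e, F, he, hFc, hr⟩ := hP.exists_range_eq_iInter_iUnion_isClosed
  refine ⟨fun α ↦ f '' (e ⁻¹' ⋂ n, ⋃ k ∈ Iic (α n), F n k), fun α β h ↦ ?_, fun α ↦ ?_,
    fun x ↦ ?_⟩
  · refine image_mono (preimage_mono (iInter_mono fun n ↦ biUnion_subset_biUnion_left ?_))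
    exact Iic_subset_Iic.2 (h n)
  · refine IsCompact.image ((he.isInducing.isCompact_preimage_iff ?_).2 ?_) hf
    · rw [hr]
      exact iInter_mono fun n ↦ iUnion₂_subset fun k _ ↦ subset_iUnion _ k
    · exact (isClosed_iInter fun n ↦ (finite_Iic _).isClosed_biUnion fun k _ ↦ hFc n k).isCompact
  · obtain ⟨p, rfl⟩ := hfs x
    have hp : e p ∈ ⋂ n, ⋃ k, F n k := hr ▸ mem_range_self p
    simp only [mem_iInter, mem_iUnion] at hp
    choose α hα using hp
    exact ⟨α, p, mem_iInter.2 fun n ↦ mem_biUnion (mem_Iic.2 le_rfl) (hα n), rfl⟩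

/-! ### Analyticity from closed schemes -/

/-- Upper semicontinuity of `α ↦ ⋂ i, H i (α i)`: by compactness, containment in an open set is
decided by finitely many coordinates of `α`. -/
theorem isOpen_setOf_iInter_subset {C ι κ : Type*} [TopologicalSpace C] [CompactSpace C]
    [TopologicalSpace κ] [DiscreteTopology κ] {H : ι → κ → Set C} (hH : ∀ i k, IsClosed (H i k))
    {O : Set C} (hO : IsOpen O) :
    IsOpen {α : ι → κ | ⋂ i, H i (α i) ⊆ O} := by
  refine isOpen_iff_mem_nhds.2 fun α hα ↦ ?_
  obtain ⟨t, ht⟩ := hO.isClosed_compl.isCompact.elim_finite_subfamily_closed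
    (fun i ↦ H i (α i)) (fun i ↦ hH i _) (by
      rw [inter_comm, ← sdiff_eq, sdiff_eq_empty]; exact hα)
  have hn : ∀ᶠ β in 𝓝 α, ∀ i ∈ t, β i = α i := by
    refine (Finset.eventually_all t).2 fun i _ ↦ ?_
    exact (continuous_apply i).continuousAt.eventually_mem (by simp : {α i} ∈ 𝓝 (α i))
  filter_upwards [hn] with β hβ x hx
  by_contra hxO
  have : x ∈ Oᶜ ∩ ⋂ i ∈ t, H i (α i) := by
    refine ⟨hxO, mem_iInter₂.2 fun i hi ↦ ?_⟩
    rw [← hβ i hi]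
    exact mem_iInter.1 hx i
  rw [ht] at this
  exact this

/-- The sets `e ⁻¹' ⋂ i, H i (α i)` form an upper semicontinuous compact-valued family covering
`P`. If `f` is constant on each of them, then `α ↦` (the constant value) is a continuous map onto
`X` from the set of those `α` for which the intersection is nonempty, a closed subset of a Polish
space. -/
theorem isAnalyticSpace_of_closed_scheme {X P C : Type u} [TopologicalSpace X] [TopologicalSpace P]
    [TopologicalSpace C] [CompactSpace C] {e : P → C} (he : IsInducing e) {f : P → X}
    (hf : Continuous f) (hfs : Function.Surjective f) {ι : Type} [Countable ι]
    {H : ι → ℕ → Set C} (hH : ∀ i k, IsClosed (H i k))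
    (hr : ∀ α : ι → ℕ, ⋂ i, H i (α i) ⊆ range e) (hcov : ∀ p i, ∃ k, e p ∈ H i k)
    (hconst : ∀ (α : ι → ℕ) (p q : P), (∀ i, e p ∈ H i (α i)) → (∀ i, e q ∈ H i (α i)) →
      f p = f q) :
    IsAnalyticSpace X := by
  let S : Set (ι → ℕ) := {α | (⋂ i, H i (α i)).Nonempty}
  have hS : IsClosed S := by
    have := isOpen_setOf_iInter_subset hH isOpen_empty
    rw [← isOpen_compl_iff]
    convert this using 1
    ext α
    rw [mem_compl_iff, mem_ofPred_eq, not_nonempty_iff_eq_empty, mem_ofPred_eq, subset_empty_iff]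
  have hex (α : S) : ∃ p, ∀ i, e p ∈ H i (α.1 i) := by
    obtain ⟨c, hc⟩ := α.2
    obtain ⟨p, rfl⟩ := hr _ hc
    exact ⟨p, mem_iInter.1 hc⟩
  choose s hs using hex
  have hPolish : PolishSpace S := hS.polishSpace
  have hcont : Continuous (fun α ↦ f (s α)) := by
    refine continuous_def.2 fun U hU ↦ ?_
    obtain ⟨O, hO, hOU⟩ := he.isOpen_iff.1 (hU.preimage hf)
    convert (isOpen_setOf_iInter_subset hH hO).preimage continuous_subtype_val using 1
    ext α
    have hmem (p : P) : e p ∈ O ↔ f p ∈ U := by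
      rw [← mem_preimage, hOU, mem_preimage]
    simp only [mem_preimage, mem_ofPred_eq]
    constructor
    · intro h c hc
      obtain ⟨p, rfl⟩ := hr _ hc
      rwa [hmem, hconst α p (s α) (mem_iInter.1 hc) (hs α)]
    · intro h
      exact (hmem _).1 (h (mem_iInter.2 (hs α)))
  refine ⟨ULift.{u} S, inferInstance, Homeomorph.ulift.isClosedEmbedding.polishSpace,
    (fun α ↦ f (s α)) ∘ ULift.down, hcont.comp continuous_uliftDown, fun x ↦ ?_⟩
  obtain ⟨p, rfl⟩ := hfs x
  choose α hα using hcov p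
  have hαS : α ∈ S := ⟨e p, mem_iInter.2 hα⟩
  exact ⟨⟨⟨α, hαS⟩⟩, hconst α _ _ (hs ⟨α, hαS⟩) hα⟩

/-! ### Countable separating families -/
theorem exists_separating_open_pairs (X : Type*) [TopologicalSpace X] [T2Space X]
    [HereditarilyLindelofSpace (X × X)] :
    ∃ A B : ℕ → Set X, (∀ n, IsOpen (A n)) ∧ (∀ n, IsOpen (B n)) ∧ (∀ n, Disjoint (A n) (B n)) ∧
      ∀ x y, x ≠ y → ∃ n, x ∈ A n ∧ y ∈ B n := by
  let ι := {W : Set X × Set X // IsOpen W.1 ∧ IsOpen W.2 ∧ Disjoint W.1 W.2}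
  have : Nonempty ι := ⟨⟨(∅, ∅), isOpen_empty, isOpen_empty, disjoint_bot_left⟩⟩
  obtain ⟨r, hr⟩ := (HereditarilyLindelofSpace.isLindelof (diagonal X)ᶜ).indexed_countable_subcover
    (fun W : ι ↦ W.1.1 ×ˢ W.1.2) (fun W ↦ W.2.1.prod W.2.2.1) (fun z hz ↦ by
      obtain ⟨U, V, hU, hV, hx, hy, hd⟩ := t2_separation (show z.1 ≠ z.2 from hz)
      exact mem_iUnion.2 ⟨⟨(U, V), hU, hV, hd⟩, hx, hy⟩)
  refine ⟨fun n ↦ (r n).1.1, fun n ↦ (r n).1.2, fun n ↦ (r n).2.1, fun n ↦ (r n).2.2.1,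
    fun n ↦ (r n).2.2.2, fun x y hxy ↦ ?_⟩
  obtain ⟨n, hn⟩ := mem_iUnion.1 (hr (show (x, y) ∈ (diagonal X)ᶜ from hxy))
  exact ⟨n, hn⟩

/-- The scheme has indices `Sum.inl n`, whose sets `F n k` cut out `P` in its compactification, and
`Sum.inr n`, whose two sets record whether the image avoids `A n` or avoids `B n`. -/
theorem IsKAnalyticSpace.isAnalyticSpace {X : Type u} [TopologicalSpace X] [T2Space X]
    [HereditarilyLindelofSpace (X × X)] (hX : IsKAnalyticSpace X) : IsAnalyticSpace X := by
  obtain ⟨P, _, hP, _, f, hf, hfs⟩ := hX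
  obtain ⟨C, _, _, _, e, F, he, hFc, hr⟩ := hP.exists_range_eq_iInter_iUnion_isClosed
  obtain ⟨A, B, hA, hB, hAB, hsep⟩ := exists_separating_open_pairs X
  choose D hD hDe using fun n ↦ he.isInducing.isClosed_iff.1 ((hA n).isClosed_compl.preimage hf)
  choose E hE hEe using fun n ↦ he.isInducing.isClosed_iff.1 ((hB n).isClosed_compl.preimage hf)
  have hDm (n p) : e p ∈ D n ↔ f p ∉ A n := by rw [← mem_preimage, hDe]; rfl
  have hEm (n p) : e p ∈ E n ↔ f p ∉ B n := by rw [← mem_preimage, hEe]; rfl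
  refine isAnalyticSpace_of_closed_scheme (ι := ℕ ⊕ ℕ) he.isInducing hf hfs
    (H := Sum.elim F fun n k ↦ if k = 0 then D n else E n) ?_ ?_ ?_ ?_
  · rintro (n | n) k
    · exact hFc n k
    · dsimp; split_ifs
      exacts [hD n, hE n]
  · intro α c hc
    rw [hr]
    exact mem_iInter.2 fun n ↦ mem_iUnion.2 ⟨_, mem_iInter.1 hc (Sum.inl n)⟩
  · rintro p (n | n)
    · have hp : e p ∈ ⋂ n, ⋃ k, F n k := hr ▸ mem_range_self p
      exact mem_iUnion.1 (mem_iInter.1 hp n)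
    · by_cases h : f p ∈ A n
      · exact ⟨1, by simpa [hEm] using disjoint_left.1 (hAB n) h⟩
      · exact ⟨0, by simpa [hDm] using h⟩
  · intro α p q hp hq
    by_contra hpq
    obtain ⟨n, hpA, hqB⟩ := hsep _ _ hpq
    have h1 := hp (Sum.inr n)
    have h2 := hq (Sum.inr n)
    dsimp at h1 h2
    split_ifs at h1 h2
    · exact (hDm n p).1 h1 hpA
    · exact (hEm n q).1 h2 hqB

theorem SecondCountableTopology.of_continuous_injective {X Y : Type*} [TopologicalSpace X]
    [CompactSpace X] [TopologicalSpace Y] [T2Space Y] [SecondCountableTopology Y] {f : X → Y}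
    (hf : Continuous f) (hfi : Function.Injective f) : SecondCountableTopology X :=
  (hf.isClosedEmbedding hfi).isEmbedding.secondCountableTopology

/-- The countable separating pairs generate a second countable Hausdorff topology that is coarser
than the compact one, and therefore equal to it. -/
theorem metrizableSpace_of_compact_of_hereditarilyLindelof_prod (K : Type*)
    [t : TopologicalSpace K] [CompactSpace K] [T2Space K] [HereditarilyLindelofSpace (K × K)] :
    TopologicalSpace.MetrizableSpace K := by
  obtain ⟨A, B, hA, hB, hAB, hsep⟩ := exists_separating_open_pairs K
  suffices SecondCountableTopology K from TopologicalSpace.metrizableSpace_of_t3_secondCountable K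
  let g : Set (Set K) := range A ∪ range B
  have hle : t ≤ TopologicalSpace.generateFrom g := by
    refine le_generateFrom ?_
    rintro _ (⟨n, rfl⟩ | ⟨n, rfl⟩)
    exacts [hA n, hB n]
  have ht2 : @T2Space K (.generateFrom g) := by
    refine @T2Space.mk K (.generateFrom g) fun x y hxy ↦ ?_
    obtain ⟨n, hx, hy⟩ := hsep x y hxy
    exact ⟨A n, B n, .basic _ (.inl ⟨n, rfl⟩), .basic _ (.inr ⟨n, rfl⟩), hx, hy, hAB n⟩
  exact @SecondCountableTopology.of_continuous_injective K K t _ (.generateFrom g) ht2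
    (@SecondCountableTopology.mk K (.generateFrom g)
      ⟨g, (countable_range A).union (countable_range B), rfl⟩)
    id (continuous_id_iff_le.2 hle) Function.injective_id

theorem HereditarilyLindelofSpace.of_surjective {X Y : Type*} [TopologicalSpace X]
    [TopologicalSpace Y] [HereditarilyLindelofSpace X] {f : X → Y} (hf : Continuous f)
    (hfs : Function.Surjective f) : HereditarilyLindelofSpace Y := by
  refine .of_forall_isOpen fun s _ ↦ ?_
  rw [← image_preimage_eq s hfs]
  exact (HereditarilyLindelofSpace.isLindelof _).image hf

theorem HereditarilyLindelofSpace.of_countable (X : Type*) [TopologicalSpace X] [Countable X] :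
    HereditarilyLindelofSpace X :=
  .of_forall_isOpen fun s _ ↦ s.to_countable.isLindelof

theorem IsAnalyticSpace.metrizableSpace_of_isCompact {X : Type u} [TopologicalSpace X] [T2Space X]
    (hX : IsAnalyticSpace X) {K : Set X} (hK : IsCompact K) :
    TopologicalSpace.MetrizableSpace K := by
  obtain ⟨P, _, _, f, hf, hfs⟩ := hX
  have : CompactSpace K := isCompact_iff_compactSpace.1 hK
  let g : f ⁻¹' K → K := K.restrictPreimage f
  have hg : Continuous g := hf.restrictPreimage
  have hgs : Function.Surjective g := restrictPreimage_surjective K hfs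
  have : HereditarilyLindelofSpace (K × K) :=
    .of_surjective (hg.prodMap hg) (hgs.prodMap hgs)
  exact metrizableSpace_of_compact_of_hereditarilyLindelof_prod K

/-! ### Consequences of `ω₁ < 𝔟` -/
theorem exists_wellOrder_mk_eq_aleph_one :
    ∃ (T : Type) (_ : LinearOrder T) (_ : WellFoundedLT T), #T = ℵ₁ ∧ ∀ t : T, (Iio t).Countable :=
  ⟨(ℵ₁ : Cardinal.{0}).ord.ToType, inferInstance, inferInstance, by simp, fun t ↦ by
    rw [← le_aleph0_iff_set_countable, ← lt_aleph_one_iff]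
    simpa using mk_Iio_lt t⟩

theorem EventuallyDominated.exists_le_add {x y : ℕ → ℕ} (h : EventuallyDominated x y) :
    ∃ m, x ≤ fun n ↦ y n + m := by
  obtain ⟨m, hm⟩ := (h.image x).bddAbove
  refine ⟨m, fun n ↦ ?_⟩
  by_cases hn : x n ≤ y n
  · exact hn.trans (Nat.le_add_right _ _)
  · exact (hm ⟨n, hn, rfl⟩).trans (Nat.le_add_left _ _)

/-- If `ω₁ < 𝔟`, then some `y` eventually dominates all `α t`, and each `α t` lies below one of the
countably many functions `y + m`. -/
theorem exists_not_countable_setOf_le (h : ℵ₁ < boundingNumber) {T : Type} (hT : #T = ℵ₁)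
    (α : T → ℕ → ℕ) : ∃ β, ¬ {t | α t ≤ β}.Countable := by
  have hr : #(range α) ≤ ℵ₁ := hT ▸ mk_range_le
  have hb := notMem_of_lt_csInf' (hr.trans_lt h)
  simp only [mem_ofPred_eq, not_exists, not_and, not_forall, not_not] at hb
  obtain ⟨y, hy⟩ := hb _ rfl
  by_contra! hc
  have huniv : (univ : Set T) ⊆ ⋃ m : ℕ, {t | α t ≤ fun n ↦ y n + m} := fun t _ ↦
    mem_iUnion.2 (hy (α t) (mem_range_self t)).exists_le_add
  have := (countable_iUnion fun m : ℕ ↦ hc fun n ↦ y n + m).mono huniv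
  rw [countable_univ_iff, ← mk_le_aleph0_iff, hT] at this
  exact aleph0_lt_aleph_one.not_ge this

/-- If `S` has a cover without countable subcovers, recursion along `T` picks points of `S`
outside the cover members chosen before. -/
theorem exists_rightSeparated {Y ι : Type*} {S : Set Y} {U : ι → Set Y} (hS : S ⊆ ⋃ i, U i)
    (hU : ∀ J : Set ι, J.Countable → ¬ S ⊆ ⋃ i ∈ J, U i) {T : Type} [LinearOrder T]
    [WellFoundedLT T] (hT : ∀ t : T, (Iio t).Countable) :
    ∃ (y : T → Y) (i : T → ι), ∀ t, y t ∈ U (i t) ∧ ∀ s < t, y t ∉ U (i s) := by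
  have hstep (J : Set ι) : ∃ (y : Y) (i : ι), J.Countable → y ∈ U i ∧ ∀ j ∈ J, y ∉ U j := by
    obtain ⟨y₀, hy₀, -⟩ := not_subset.1 (hU ∅ countable_empty)
    obtain ⟨i₀, -⟩ := mem_iUnion.1 (hS hy₀)
    by_cases hJ : J.Countable
    · obtain ⟨y, hy, hyJ⟩ := not_subset.1 (hU J hJ)
      obtain ⟨i, hi⟩ := mem_iUnion.1 (hS hy)
      exact ⟨y, i, fun _ ↦ ⟨hi, by simpa using hyJ⟩⟩
    · exact ⟨y₀, i₀, fun h ↦ absurd h hJ⟩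
  choose p g hpg using hstep
  let i : T → ι := (wellFounded_lt (α := T)).fix fun t ih ↦ g (range fun s : Iio t ↦ ih s.1 s.2)
  have hi (t : T) : i t = g (range fun s : Iio t ↦ i s) := WellFounded.fix_eq _ _ t
  refine ⟨fun t ↦ p (range fun s : Iio t ↦ i s), i, fun t ↦ ?_⟩
  have := (hT t).to_subtype
  obtain ⟨h1, h2⟩ := hpg (range fun s : Iio t ↦ i s) (countable_range _)
  exact ⟨hi t ▸ h1, fun s hs ↦ h2 _ ⟨⟨s, hs⟩, rfl⟩⟩

theorem exists_mem_forall_lt_of_not_countable {T : Type} [LinearOrder T]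
    (hT : ∀ t : T, (Iio t).Countable) {A : Set T} (hA : ¬ A.Countable) {J : Set T} (hJ : J.Countable) :
    ∃ t ∈ A, ∀ s ∈ J, s < t := by
  by_contra! h
  refine hA ((hJ.biUnion fun s _ ↦ (hT s).insert s).mono fun t ht ↦ ?_)
  obtain ⟨s, hs, hts⟩ := h t ht
  rcases hts.eq_or_lt with rfl | hlt
  · exact mem_biUnion hs (mem_insert _ _)
  · exact mem_biUnion hs (mem_insert_of_mem _ hlt)

/-- Otherwise there is a right-separated `ω₁`-sequence, and uncountably many of its terms lie in
one `K β`, which is hereditarily Lindelöf. -/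
theorem hereditarilyLindelofSpace_of_resolution (h : ℵ₁ < boundingNumber) {Y : Type*}
    [TopologicalSpace Y] {K : (ℕ → ℕ) → Set Y} (hmono : Monotone K) (hcov : ∀ y, ∃ α, y ∈ K α)
    (hK : ∀ α, SecondCountableTopology (K α)) : HereditarilyLindelofSpace Y := by
  refine .of_forall_isOpen fun S _ ↦ isLindelof_of_countable_subcover fun {ι} U hU hS ↦ ?_
  by_contra! hJ
  obtain ⟨T, _, _, hT, hTc⟩ := exists_wellOrder_mk_eq_aleph_one
  obtain ⟨y, i, hyi⟩ := exists_rightSeparated hS hJ hTc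
  choose α hα using fun t ↦ hcov (y t)
  obtain ⟨β, hβ⟩ := exists_not_countable_setOf_le h hT α
  let A := {t | α t ≤ β}
  let V : A → Set (K β) := fun t ↦ Subtype.val ⁻¹' U (i t.1)
  obtain ⟨J, hJc, hJU⟩ := (HereditarilyLindelofSpace.isLindelof (⋃ t, V t)).elim_countable_subcover
    V (fun t ↦ (hU _).preimage continuous_subtype_val) subset_rfl
  obtain ⟨t, htA, ht⟩ := exists_mem_forall_lt_of_not_countable hTc hβ (hJc.image Subtype.val)
  have hmem : (⟨y t, hmono htA (hα t)⟩ : K β) ∈ ⋃ t, V t :=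
    mem_iUnion.2 ⟨⟨t, htA⟩, (hyi t).1⟩
  obtain ⟨s, hsJ, hs⟩ := mem_iUnion₂.1 (hJU hmem)
  exact (hyi t).2 s (ht _ (mem_image_of_mem _ hsJ)) hs

theorem IsKAnalyticSpace.hereditarilyLindelofSpace_prod (h : ℵ₁ < boundingNumber) {X : Type u}
    [TopologicalSpace X] (hX : IsKAnalyticSpace X)
    (hK : ∀ K : Set X, IsCompact K → TopologicalSpace.MetrizableSpace K) :
    HereditarilyLindelofSpace (X × X) := by
  obtain ⟨K, hmono, hKc, hcov⟩ := hX.exists_compact_resolution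
  refine hereditarilyLindelofSpace_of_resolution h (K := fun α ↦ K α ×ˢ K α)
    (fun α β hαβ ↦ prod_mono (hmono hαβ) (hmono hαβ)) (fun z ↦ ?_) fun α ↦ ?_
  · obtain ⟨α, hα⟩ := hcov z.1
    obtain ⟨β, hβ⟩ := hcov z.2
    exact ⟨α ⊔ β, hmono le_sup_left hα, hmono le_sup_right hβ⟩
  · have := hK _ (hKc α)
    have : CompactSpace (K α) := isCompact_iff_compactSpace.1 (hKc α)
    let := TopologicalSpace.metrizableSpaceMetric (K α)
    exact (Homeomorph.Set.prod (K α) (K α)).isEmbedding.secondCountableTopology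

theorem IsKAnalyticSpace.countable_of_isCompact_countable (h : ℵ₁ < boundingNumber) {X : Type u}
    [TopologicalSpace X] (hX : IsKAnalyticSpace X) (hK : ∀ K : Set X, IsCompact K → K.Countable) :
    Countable X := by
  obtain ⟨K, hmono, hKc, hcov⟩ := hX.exists_compact_resolution
  by_contra hX'
  obtain ⟨T, _, _, hT, -⟩ := exists_wellOrder_mk_eq_aleph_one
  have hle : Cardinal.lift.{u} #T ≤ Cardinal.lift.{0} #X := by
    rwa [hT, ← not_lt, Cardinal.lift_uzero, lift_aleph, Ordinal.lift_one, lt_aleph_one_iff,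
      mk_le_aleph0_iff]
  obtain ⟨y⟩ := Cardinal.lift_mk_le'.1 hle
  choose α hα using fun t ↦ hcov (y t)
  obtain ⟨β, hβ⟩ := exists_not_countable_setOf_le h hT α
  refine hβ (MapsTo.countable_of_injOn (fun t ht ↦ ?_) y.injective.injOn (hK _ (hKc β)))
  exact hmono ht (hα t)

theorem IsAnalyticSpace.countable_of_hasUniqueNonisolatedPoint {X : Type u} [TopologicalSpace X]
    (hX : IsAnalyticSpace X) (hx : HasUniqueNonisolatedPoint X) : Countable X := by
  obtain ⟨P, _, _, f, hf, hfs⟩ := hX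
  obtain ⟨x, -, hx⟩ := hx
  have : TopologicalSpace.SeparableSpace X := hfs.denseRange.separableSpace hf
  obtain ⟨D, hDc, hD⟩ := TopologicalSpace.exists_countable_dense X
  refine countable_univ_iff.1 ((hDc.insert x).mono fun y _ ↦ ?_)
  by_cases hy : IsOpen {y}
  · obtain ⟨z, rfl, hz⟩ := hD.inter_open_nonempty _ hy (singleton_nonempty y)
    exact mem_insert_of_mem _ hz
  · exact hx y hy ▸ mem_insert _ _

/-! ### A concentrated family of functions from `𝔟 ≤ ω₁` -/
theorem exists_forall_eventuallyDominated {ι : Type*} [Countable ι] (x : ι → ℕ → ℕ) :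
    ∃ y, ∀ i, EventuallyDominated (x i) y := by
  rcases isEmpty_or_nonempty ι with h | h
  · exact ⟨0, h.elim⟩
  obtain ⟨r, hr⟩ := exists_surjective_nat ι
  refine ⟨fun n ↦ ∑ m ∈ Finset.range (n + 1), x (r m) n, fun i ↦ ?_⟩
  obtain ⟨m, rfl⟩ := hr i
  refine (finite_Iio m).subset fun n hn ↦ ?_
  by_contra hmn
  refine hn (Finset.single_le_sum (f := fun m ↦ x (r m) n) (fun _ _ ↦ Nat.zero_le _) ?_)
  simpa [Nat.lt_succ_iff] using hmn

/-- Enumerate an unbounded family as `g s`, `s : T`, along a well-order of type `ω₁`, and let `y t`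
eventually dominate all `g s` with `s < t`. If uncountably many `y t` were below `α`, then `α`
would eventually dominate every `g s`. -/
theorem exists_concentrated_family (h : boundingNumber ≤ ℵ₁) :
    ∃ (I : Type) (b : I → ℕ → ℕ), Uncountable I ∧ ∀ α, {i | b i ≤ α}.Countable := by
  have hmem : boundingNumber ∈ {κ : Cardinal.{0} | ∃ B : Set (ℕ → ℕ),
      #B = κ ∧ ∀ y : ℕ → ℕ, ∃ x ∈ B, ¬ EventuallyDominated x y} := by
    refine csInf_mem ⟨_, univ, rfl, fun y ↦ ⟨fun n ↦ y n + 1, mem_univ _, fun hy ↦ ?_⟩⟩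
    refine Set.infinite_univ (hy.subset fun n _ ↦ ?_)
    simp
  obtain ⟨B, hB, hBu⟩ := hmem
  obtain ⟨T, _, _, hT, hTc⟩ := exists_wellOrder_mk_eq_aleph_one
  have hBne : Nonempty B := let ⟨x, hx, _⟩ := hBu 0; ⟨⟨x, hx⟩⟩
  obtain ⟨j⟩ : Nonempty (B ↪ T) := by rw [← Cardinal.le_def, hB, hT]; exact h
  let g : T → B := Function.invFun j
  have hg : Function.Surjective g := Function.invFun_surjective j.injective
  have hdom (t : T) : ∃ y, ∀ s : Iio t, EventuallyDominated (g s) y :=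
    have := (hTc t).to_subtype
    exists_forall_eventuallyDominated _
  choose y hy using hdom
  refine ⟨T, y, ?_, fun α ↦ ?_⟩
  · rw [← aleph0_lt_mk_iff, hT]
    exact aleph0_lt_aleph_one
  · by_contra hα
    obtain ⟨x, hxB, hx⟩ := hBu α
    obtain ⟨s, hs⟩ := hg ⟨x, hxB⟩
    obtain ⟨t, htα, ht⟩ := exists_mem_forall_lt_of_not_countable hTc hα (countable_singleton s)
    have hst := hy t ⟨s, ht s rfl⟩
    rw [hs] at hst
    exact hx (hst.subset fun n hn hle ↦ hn (hle.trans (htα n)))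

/-! ### Closed subsets of `(ℕ → ℕ) × A` with `A` compact -/
theorem lindelofSpace_prod_of_compactSpace (X Y : Type*) [TopologicalSpace X] [TopologicalSpace Y]
    [LindelofSpace X] [CompactSpace Y] : LindelofSpace (X × Y) := by
  refine ⟨isLindelof_of_countable_subcover fun {ι} U hU hcov ↦ ?_⟩
  have key (x : X) : ∃ (t : Finset ι) (V : Set X), IsOpen V ∧ x ∈ V ∧
      V ×ˢ univ ⊆ ⋃ i ∈ t, U i := by
    obtain ⟨t, ht⟩ := (isCompact_singleton (x := x)).prod (isCompact_univ (X := Y))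
      |>.elim_finite_subcover U hU ((subset_univ _).trans hcov)
    obtain ⟨V, W, hV, -, hxV, hW, hVW⟩ := generalized_tube_lemma isCompact_singleton isCompact_univ
      (isOpen_biUnion fun i _ ↦ hU i) ht
    exact ⟨t, V, hV, hxV rfl, (prod_mono_right hW).trans hVW⟩
  choose t V hV hxV ht using key
  obtain ⟨J, hJ, hJc⟩ := (isLindelof_univ (X := X)).elim_countable_subcover V hV
    fun x _ ↦ mem_iUnion.2 ⟨x, hxV x⟩
  refine ⟨⋃ x ∈ J, (t x : Set ι), hJ.biUnion fun x _ ↦ (t x).countable_toSet, fun z _ ↦ ?_⟩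
  obtain ⟨x, hx, hz⟩ := mem_iUnion₂.1 (hJc (mem_univ z.1))
  obtain ⟨i, hi, hzi⟩ := mem_iUnion₂.1 (ht x ⟨hz, mem_univ z.2⟩)
  exact mem_biUnion (mem_biUnion hx hi) hzi

/-- The compactification is the closure in `(ℕ → OnePoint ℕ) × A`; the points of the original set
are exactly those all of whose coordinates in `OnePoint ℕ` are finite. -/
theorem IsClosed.isCechComplete_of_baire_prod_compact {A : Type u} [TopologicalSpace A]
    [CompactSpace A] [T2Space A] {P : Set ((ℕ → ℕ) × A)} (hP : IsClosed P) : IsCechComplete P := by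
  refine ⟨inferInstance, ?_⟩
  let φ : (ℕ → ℕ) × A → (ℕ → OnePoint ℕ) × A := Prod.map (Pi.map fun _ ↦ OnePoint.some) id
  have hφ : IsEmbedding φ :=
    (IsEmbedding.piMap fun _ ↦ OnePoint.isOpenEmbedding_coe.isEmbedding).prodMap .id
  let C := closure (φ '' P)
  have hC : CompactSpace C := isCompact_iff_compactSpace.1 isClosed_closure.isCompact
  let e : P → C := fun p ↦ ⟨φ p, subset_closure (mem_image_of_mem _ p.2)⟩
  have he : IsEmbedding e :=
    (hφ.comp IsEmbedding.subtypeVal).codRestrict C fun p ↦ subset_closure (mem_image_of_mem _ p.2)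
  refine ⟨C, inferInstance, hC, inferInstance, e, ⟨⟨he.isInducing, ?_⟩, he.injective⟩, ?_⟩
  · refine Subtype.dense_iff.2 (closure_mono ?_)
    rintro _ ⟨p, hp, rfl⟩
    exact ⟨e ⟨p, hp⟩, mem_range_self _, rfl⟩
  · have hr : range e = ⋂ n : ℕ, {c : C | c.1.1 n ≠ OnePoint.infty} := by
      ext c
      simp only [mem_range, mem_iInter, mem_ofPred_eq]
      constructor
      · rintro ⟨p, rfl⟩ n
        exact OnePoint.coe_ne_infty _
      · intro hc
        choose α hα using fun n ↦ OnePoint.ne_infty_iff_exists.1 (hc n)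
        have hφc : φ (α, c.1.2) = c.1 := Prod.ext (funext hα) rfl
        have hmem : (α, c.1.2) ∈ P := by
          rw [← hP.closure_eq, hφ.isInducing.closure_eq_preimage_closure_image, mem_preimage, hφc]
          exact c.2
        exact ⟨⟨_, hmem⟩, Subtype.ext hφc⟩
    rw [hr]
    refine .iInter_of_isOpen fun n ↦ ?_
    exact isOpen_compl_singleton.preimage
      ((continuous_apply n).comp (continuous_fst.comp continuous_subtype_val))

/-! ### The counterexample -/

/-- The set `I` with one extra point `apex`. The leaves are isolated, and a set containing the apex
is open if, for every `α`, it omits only finitely many leaves `i` with `b i ≤ α`. -/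
inductive BoundedFan {I : Type u} (b : I → ℕ → ℕ) : Type u
  | apex
  | leaf (i : I)

namespace BoundedFan

variable {I : Type u} {b : I → ℕ → ℕ}

instance : TopologicalSpace (BoundedFan b) where
  IsOpen U := apex ∈ U → ∀ α, {i : I | b i ≤ α ∧ leaf i ∉ U}.Finite
  isOpen_univ := by simp
  isOpen_inter U V hU hV h α := by
    refine ((hU h.1 α).union (hV h.2 α)).subset ?_
    rintro i ⟨hi, hiUV⟩
    by_cases hiU : leaf i ∈ U
    · exact .inr ⟨hi, fun hiV ↦ hiUV ⟨hiU, hiV⟩⟩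
    · exact .inl ⟨hi, hiU⟩
  isOpen_sUnion S hS := by
    rintro ⟨U, hU, h⟩ α
    exact (hS U hU h α).subset fun i hi ↦ ⟨hi.1, fun hiU ↦ hi.2 ⟨U, hU, hiU⟩⟩

theorem isOpen_iff {U : Set (BoundedFan b)} : IsOpen U ↔
    (apex ∈ U → ∀ α, {i : I | b i ≤ α ∧ leaf i ∉ U}.Finite) := Iff.rfl

theorem leaf_injective : Function.Injective (leaf : I → BoundedFan b) := fun _ _ h ↦ leaf.inj h

theorem isOpen_of_apex_notMem {U : Set (BoundedFan b)} (hU : apex ∉ U) : IsOpen U :=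
  fun h ↦ absurd h hU

theorem isOpen_compl_singleton_leaf (i : I) :
    IsOpen ({leaf i}ᶜ : Set (BoundedFan b)) := by
  refine isOpen_iff.2 fun _ α ↦ (finite_singleton i).subset fun k hk ↦ ?_
  exact leaf_injective (not_not.1 hk.2)

instance : T2Space (BoundedFan b) where
  t2 x y hxy := by
    have key (i : I) : ∃ U V : Set (BoundedFan b), IsOpen U ∧ IsOpen V ∧
        leaf i ∈ U ∧ (∀ z, z ≠ leaf i → z ∈ V) ∧ Disjoint U V :=
      ⟨{leaf i}, {leaf i}ᶜ, isOpen_of_apex_notMem (by simp),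
        isOpen_compl_singleton_leaf i, rfl, fun z hz ↦ hz, disjoint_compl_right⟩
    cases x with
    | leaf i =>
      obtain ⟨U, V, hU, hV, hi, hz, hd⟩ := key i
      exact ⟨U, V, hU, hV, hi, hz y hxy.symm, hd⟩
    | apex =>
      cases y with
      | leaf i =>
        obtain ⟨U, V, hU, hV, hi, hz, hd⟩ := key i
        exact ⟨V, U, hV, hU, hz _ hxy, hi, hd.symm⟩
      | apex => exact absurd rfl hxy

/-- A compact set whose leaves are unbounded at some coordinate `n` would contain leaves `d m` with
`m < b (d m) n`; these form an infinite closed discrete set, as only finitely many of them lie below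
any `α`. So the leaves of a compact set lie below one function. -/
theorem countable_of_isCompact (hb : ∀ α, {i | b i ≤ α}.Countable) {K : Set (BoundedFan b)}
    (hK : IsCompact K) : K.Countable := by
  suffices ∃ α, ∀ i : I, leaf i ∈ K → b i ≤ α by
    obtain ⟨α, hα⟩ := this
    refine (((hb α).image leaf).insert apex).mono fun x hx ↦ ?_
    cases x with
    | leaf i => exact .inr ⟨i, hα i hx, rfl⟩
    | apex => exact .inl rfl
  suffices ∀ n, ∃ m, ∀ i : I, leaf i ∈ K → b i n ≤ m by
    choose α hα using this
    exact ⟨α, fun i hi n ↦ hα n i hi⟩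
  intro n
  by_contra! hunb
  choose d hdK hd using hunb
  have hopen (s : Set ℕ) : IsOpen ((fun m ↦ leaf (d m)) '' s : Set (BoundedFan b))ᶜ := by
    refine isOpen_iff.2 fun _ α ↦ ((finite_Iio (α n)).image d).subset ?_
    rintro _ ⟨hi, hid⟩
    obtain ⟨m, -, hm⟩ := not_not.1 hid
    obtain rfl := leaf_injective hm
    exact ⟨m, (hd m).trans_le (hi n), rfl⟩
  have hcov : K ⊆ ⋃ m, ((fun m ↦ leaf (d m)) '' Ici m : Set (BoundedFan b))ᶜ := fun x _ ↦ by
    refine mem_iUnion.2 ?_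
    by_contra! hx
    obtain ⟨m, -, hm⟩ := not_not.1 (hx 0)
    obtain ⟨k, hk, hkm⟩ := not_not.1 (hx (b (d m) n))
    have hdk := hd k
    rw [leaf_injective (hkm.trans hm.symm)] at hdk
    exact (mem_Ici.1 hk).not_gt hdk
  obtain ⟨t, ht⟩ := hK.elim_directed_cover _ (fun m ↦ hopen (Ici m)) hcov
    (directed_of_isDirected_le fun m k hmk ↦
      compl_subset_compl.2 (image_mono (Ici_subset_Ici.2 hmk)))
  exact ht (hdK t) ⟨t, self_mem_Ici, rfl⟩

/-- If only finitely many members of `D` lie below any given function, then a member of `D` below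
`α` at the first `n` coordinates is already below `α`, for a suitable `n`. Otherwise, choosing a
witness `i n` for each `n`, all `b (i n)` lie below one function `γ`, so some `i n` occurs
infinitely often. -/
theorem exists_forall_lt_le_of_finite {D : Set I} (hD : ∀ γ, {i | b i ≤ γ ∧ i ∈ D}.Finite)
    (α : ℕ → ℕ) : ∃ n, ∀ i ∈ D, (∀ k < n, b i k ≤ α k) → b i ≤ α := by
  by_contra! h
  choose i hiD hiα hi using h
  -- Coordinate `k` of `b (i n)` is at most `α k` for `k < n` and a summand of `γ k` for `n ≤ k`.
  let γ : ℕ → ℕ := fun k ↦ α k + ∑ m ∈ Finset.range (k + 1), b (i m) k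
  have hγ (n : ℕ) : b (i n) ≤ γ := fun k ↦ by
    rcases lt_or_ge k n with hkn | hkn
    · exact (hiα n k hkn).trans (Nat.le_add_right _ _)
    · refine le_trans ?_ (Nat.le_add_left _ _)
      exact Finset.single_le_sum (f := fun m ↦ b (i m) k) (fun _ _ ↦ Nat.zero_le _)
        (Finset.mem_range.2 (Nat.lt_succ_of_le hkn))
  have := (hD γ).to_subtype
  obtain ⟨c, hc⟩ := Finite.exists_infinite_fiber
    (fun n ↦ (⟨i n, hγ n, hiD n⟩ : {i | b i ≤ γ ∧ i ∈ D}))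
  have hc' := Set.infinite_coe_iff.1 hc
  obtain ⟨n₀, hn₀⟩ := hc'.nonempty
  refine hi n₀ fun k ↦ ?_
  obtain ⟨n, hn, hkn⟩ := hc'.exists_gt k
  have heq : i n₀ = i n := congrArg Subtype.val (hn₀.trans hn.symm)
  rw [heq]
  exact hiα n k hkn

/-- The fan is the image of the closed set of pairs `(α, x)` in `(ℕ → ℕ) × OnePoint I` such that `x`
is the point at infinity or `b x ≤ α`. -/
theorem isKAnalyticSpace (b : I → ℕ → ℕ) : IsKAnalyticSpace (BoundedFan b) := by
  let _ : TopologicalSpace I := ⊥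
  have : DiscreteTopology I := ⟨rfl⟩
  let P : Set ((ℕ → ℕ) × OnePoint I) := {p | ∀ i : I, p.2 = i → b i ≤ p.1}
  have hsing (i : I) : IsOpen {(i : OnePoint I)} := by
    simpa using OnePoint.isOpenMap_coe _ (isOpen_discrete {i})
  have hP : IsClosed P := by
    have : Pᶜ = ⋃ i : I, (Ici (b i))ᶜ ×ˢ {(i : OnePoint I)} := by
      ext p
      simp [P, and_comm]
    rw [← isOpen_compl_iff, this]
    exact isOpen_iUnion fun i ↦ isClosed_Ici.isOpen_compl.prod (hsing i)
  have hL : LindelofSpace P :=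
    have := lindelofSpace_prod_of_compactSpace (ℕ → ℕ) (OnePoint I)
    isLindelof_iff_lindelofSpace.1 hP.isLindelof
  refine ⟨P, inferInstance, hP.isCechComplete_of_baire_prod_compact, hL,
    fun p ↦ p.1.2.elim apex leaf, ?_, ?_⟩
  · refine continuous_def.2 fun U hU ↦ isOpen_iff_mem_nhds.2 ?_
    rintro ⟨⟨α, x⟩, hp⟩ hxU
    induction x using OnePoint.rec with
    | coe i =>
      filter_upwards [((hsing i).preimage (continuous_snd.comp continuous_subtype_val)).mem_nhds
        (x := (⟨(α, i), hp⟩ : P)) rfl] with q hq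
      have hq' : q.1.2 = i := hq
      rw [mem_preimage, hq']
      exact hxU
    | infty =>
      have hfin := isOpen_iff.1 hU hxU
      obtain ⟨n, hn⟩ := exists_forall_lt_le_of_finite (D := {i | leaf i ∉ U}) hfin α
      have h1 : ∀ᶠ q : P in 𝓝 ⟨(α, OnePoint.infty), hp⟩, ∀ k ∈ Finset.range n, q.1.1 k = α k := by
        refine (Finset.eventually_all _).2 fun k _ ↦ ?_
        have hc : Continuous fun q : P ↦ q.1.1 k := by fun_prop
        exact hc.continuousAt.eventually_mem (s := {α k}) (by simp)
      have h2 : ∀ᶠ q : P in 𝓝 ⟨(α, OnePoint.infty), hp⟩,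
          q.1.2 ∉ OnePoint.some '' {i : I | b i ≤ α ∧ leaf i ∉ U} := by
        have hc : Continuous fun q : P ↦ q.1.2 := by fun_prop
        exact hc.continuousAt.eventually_mem
          (((hfin α).image OnePoint.some).isClosed.isOpen_compl.mem_nhds (by simp))
      filter_upwards [h1, h2] with q hq1 hq2
      obtain ⟨⟨β, y⟩, hq⟩ := q
      induction y using OnePoint.rec with
      | infty => exact hxU
      | coe i =>
        by_contra hiU
        refine hq2 ⟨i, ⟨hn i hiU fun k hk ↦ ?_, hiU⟩, rfl⟩
        exact (hq i rfl k).trans_eq (hq1 k (Finset.mem_range.2 hk))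
  · intro x
    cases x with
    | apex => exact ⟨⟨(0, OnePoint.infty), fun i hi ↦ absurd hi (OnePoint.infty_ne_coe i)⟩, rfl⟩
    | leaf i => exact ⟨⟨(b i, i), fun k hk ↦ (OnePoint.coe_injective hk) ▸ le_rfl⟩, rfl⟩

/-- If the apex were isolated, the space would be discrete; being Lindelöf, it would be
countable. -/
theorem hasUniqueNonisolatedPoint [Uncountable I] : HasUniqueNonisolatedPoint (BoundedFan b) := by
  have hsome (i : I) : IsOpen ({leaf i} : Set (BoundedFan b)) :=
    isOpen_of_apex_notMem (by simp)
  refine ⟨apex, fun h ↦ ?_, fun x hx ↦ ?_⟩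
  · have hd : DiscreteTopology (BoundedFan b) := discreteTopology_iff_isOpen_singleton.2 fun x ↦ by
      cases x with
      | apex => exact h
      | leaf i => exact hsome i
    obtain ⟨P, _, -, _, f, hf, hfs⟩ := isKAnalyticSpace b
    have hL : IsLindelof (univ : Set (BoundedFan b)) := hfs.range_eq ▸ isLindelof_range hf
    have : Countable (BoundedFan b) := countable_univ_iff.1 hL.countable_of_discrete
    exact not_countable (α := I) (leaf_injective (b := b)).countable
  · cases x with
    | apex => rfl
    | leaf i => exact absurd (hsome i) hx

end BoundedFan

theorem exists_uncountable_isKAnalyticSpace (h : boundingNumber ≤ ℵ₁) :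
    ∃ (X : Type u) (_ : TopologicalSpace X) (_ : T2Space X), IsKAnalyticSpace X ∧
      HasUniqueNonisolatedPoint X ∧ (∀ K : Set X, IsCompact K → K.Countable) ∧ Uncountable X := by
  obtain ⟨I, b, hI, hb⟩ := exists_concentrated_family h
  let b' : ULift.{u} I → ℕ → ℕ := fun i ↦ b i.down
  have hI' : Uncountable (ULift.{u} I) := Equiv.ulift.symm.injective.uncountable
  refine ⟨BoundedFan b', inferInstance, inferInstance, BoundedFan.isKAnalyticSpace b',
    BoundedFan.hasUniqueNonisolatedPoint, fun K hK ↦ BoundedFan.countable_of_isCompact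
      (fun α ↦ (hb α).preimage ULift.down_injective) hK, ?_⟩
  exact (BoundedFan.leaf_injective (b := b')).uncountable

end

theorem mainTheorem5 :
    List.TFAE [
      Cardinal.aleph 1 < boundingNumber,
      ∀ (X : Type u) [TopologicalSpace X] [T2Space X], IsKAnalyticSpace X →
        (IsAnalyticSpace X ↔
          ∀ K : Set X, IsCompact K → TopologicalSpace.MetrizableSpace K),
      ∀ (X : Type u) [TopologicalSpace X], IsKAnalyticSpace X →
        (Countable X ↔ ∀ K : Set X, IsCompact K → K.Countable),
      ∀ (X : Type u) [TopologicalSpace X] [T2Space X], IsKAnalyticSpace X →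
        HasUniqueNonisolatedPoint X →
        (Countable X ↔ ∀ K : Set X, IsCompact K → K.Countable)] := by
  tfae_have 1 → 2 := fun h X _ _ hX ↦
    ⟨fun hA _ hK ↦ hA.metrizableSpace_of_isCompact hK, fun hK ↦
      have := hX.hereditarilyLindelofSpace_prod h hK
      hX.isAnalyticSpace⟩
  tfae_have 1 → 3 := fun h X _ hX ↦
    ⟨fun _ K _ ↦ K.to_countable, hX.countable_of_isCompact_countable h⟩
  tfae_have 3 → 4 := fun h X _ _ hX _ ↦ h X hX
  tfae_have 2 → 4 := fun h X _ _ hX hx ↦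
    ⟨fun _ K _ ↦ K.to_countable, fun hc ↦ by
      refine ((h X hX).2 fun K hK ↦ ?_).countable_of_hasUniqueNonisolatedPoint hx
      have : CompactSpace K := isCompact_iff_compactSpace.1 hK
      have : Countable K := hc K hK
      have : HereditarilyLindelofSpace (K × K) := .of_countable _
      exact metrizableSpace_of_compact_of_hereditarilyLindelof_prod K⟩
  tfae_have 4 → 1 := fun h ↦ by
    by_contra hb
    obtain ⟨X, _, _, hX, hx, hK, hu⟩ := exists_uncountable_isKAnalyticSpace.{u} (not_lt.1 hb)
    exact not_countable ((h X hX hx).2 hK)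
  tfae_finish
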